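/- All topological spaces are assumed to be Tychonoff (completely regular and Hausdorff). For a space $X$, let $C_p(X)$ be the space of all continuous functions $X\to\mathbb{R}$ with the topology of pointwise convergence. A space $Y$ is called $l$-dominated by a space $X$ if there is a continuous linear surjection $C_p(X)\to C_p(Y)$. A space is scattered if each of its nonempty subsets $A$ has a point that is isolated in $A$. A space $X$ is called $\sigma$-scattered (respectively, $\sigma$-discrete) if $X=\bigcup_{n\in\omega}X_n$, where every subspace $X_n$ is scattered (respectively, discrete). Proposition. Assume that $Y$ is $l$-dominated by $X$. If $X$ is $\sigma$-scattered, then $Y$ is $\sigma$-scattered. If $X$ is $\sigma$-discrete, then $Y$ is $\sigma$-discrete. -/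

import Mathlib

/-- `C_p(X)`: the real vector space of all continuous functions `X → ℝ`, as a linear subspace of
`ℝ^X` (with the product topology); it carries the subspace topology, which is the topology of
pointwise convergence. -/
abbrev Cp (X : Type*) [TopologicalSpace X] : Submodule ℝ (X → ℝ) :=
  continuousSubmodule X ℝ ℝ

/-- `Y` is `l`-dominated by `X`: there is a continuous linear map from `C_p(X)` onto `C_p(Y)`. -/
def LDominatedBy (Y X : Type*) [TopologicalSpace Y] [TopologicalSpace X] : Prop :=
  ∃ T : Cp X →L[ℝ] Cp Y, Function.Surjective T

/-- A set `S` is scattered (in its subspace topology): every nonempty `A ⊆ S` has a point that is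
isolated in `A`. -/
def IsScatteredSet {X : Type*} [TopologicalSpace X] (S : Set X) : Prop :=
  ∀ A : Set X, A ⊆ S → A.Nonempty → ∃ x ∈ A, ∃ U : Set X, IsOpen U ∧ U ∩ A = {x}

/-- `X` is a countable union of scattered subspaces. -/
def IsSigmaScattered (X : Type*) [TopologicalSpace X] : Prop :=
  ∃ S : ℕ → Set X, (⋃ n, S n) = Set.univ ∧ ∀ n, IsScatteredSet (S n)

/-- `X` is a countable union of discrete subspaces (not necessarily closed in `X`). -/
def IsSigmaDiscrete (X : Type*) [TopologicalSpace X] : Prop :=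
  ∃ S : ℕ → Set X, (⋃ n, S n) = Set.univ ∧ ∀ n, IsDiscrete (S n)

open Set Filter Topology

/-! For each `y`, the functional `f ↦ (T f) y` is a finite combination `l y` of evaluations at
points of `X`. Surjectivity of `T` makes the `l y` linearly independent, so only finitely many `y`
have support inside a given finite set. Split `Y` into levels on which the support has `n` points,
and let `E` consist of the points of a level with enumerated supports. The enumeration map `q : E →
X^n` has finite fibers, so discrete or scattered sets pull back along it. The projection `p` from
`E` to the level behaves like a finite-sheeted cover, because supports of constant size vary
continuously. Pushing forward along `p` rests on counting the points of `closure D` in each fiber: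
the count is upper semicontinuous, and where it is constant, isolated points of `D` have isolated
images. -/

theorem exists_nat_cover_of_countable {X ι : Type*} [Countable ι] [Nonempty ι] {P : Set X → Prop}
    {S : ι → Set X} (hS : (⋃ i, S i) = univ) (hP : ∀ i, P (S i)) :
    ∃ S' : ℕ → Set X, (⋃ n, S' n) = univ ∧ ∀ n, P (S' n) := by
  obtain ⟨g, hg⟩ := exists_surjective_nat ι
  exact ⟨S ∘ g, by rw [← hS]; exact hg.iUnion_comp S, fun n => hP _⟩

theorem IsScatteredSet.image {X Y : Type*} [TopologicalSpace X] [TopologicalSpace Y] {f : X → Y}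
    (hf : IsEmbedding f) {S : Set X} (hS : IsScatteredSet S) : IsScatteredSet (f '' S) := by
  rintro A hA ⟨y, hy⟩
  obtain ⟨x, hx, rfl⟩ := hA hy
  obtain ⟨a, ha, U, hU, hUa⟩ := hS (f ⁻¹' A)
    (fun z hz => by obtain ⟨w, hw, h⟩ := hA hz; rwa [← hf.injective h]) ⟨x, hy⟩
  obtain ⟨V, hV, rfl⟩ := hf.isOpen_iff.1 hU
  refine ⟨f a, ha, V, hV, Subset.antisymm ?_ ?_⟩
  · rintro z ⟨hzV, hzA⟩
    obtain ⟨w, -, rfl⟩ := hA hzA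
    have : w ∈ f ⁻¹' V ∩ f ⁻¹' A := ⟨hzV, hzA⟩
    rw [hUa] at this
    rw [mem_singleton_iff.1 this]; rfl
  · rintro _ rfl
    exact ⟨(hUa.symm ▸ mem_singleton a : a ∈ f ⁻¹' V ∩ f ⁻¹' A).1, ha⟩

theorem isSigmaDiscrete_of_levels {Y : Type*} [TopologicalSpace Y] (N : Y → ℕ)
    (h : ∀ n, IsSigmaDiscrete {y // N y = n}) : IsSigmaDiscrete Y := by
  choose S hS hd using h
  refine exists_nat_cover_of_countable (ι := ℕ × ℕ)
    (S := fun i => Subtype.val '' S i.1 i.2) (eq_univ_of_forall fun y => ?_)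
    fun i => (hd i.1 i.2).image IsInducing.subtypeVal
  obtain ⟨k, hk⟩ := mem_iUnion.1 (hS (N y) ▸ mem_univ (⟨y, rfl⟩ : {x // N x = N y}))
  exact mem_iUnion.2 ⟨(N y, k), _, hk, rfl⟩

theorem isSigmaScattered_of_levels {Y : Type*} [TopologicalSpace Y] (N : Y → ℕ)
    (h : ∀ n, IsSigmaScattered {y // N y = n}) : IsSigmaScattered Y := by
  choose S hS hd using h
  refine exists_nat_cover_of_countable (ι := ℕ × ℕ)
    (S := fun i => Subtype.val '' S i.1 i.2) (eq_univ_of_forall fun y => ?_)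
    fun i => (hd i.1 i.2).image IsEmbedding.subtypeVal
  obtain ⟨k, hk⟩ := mem_iUnion.1 (hS (N y) ▸ mem_univ (⟨y, rfl⟩ : {x // N x = N y}))
  exact mem_iUnion.2 ⟨(N y, k), _, hk, rfl⟩

theorem isDiscrete_univ_pi {ι X : Type*} [Finite ι] [TopologicalSpace X] {S : ι → Set X}
    (hS : ∀ i, IsDiscrete (S i)) : IsDiscrete (univ.pi S) := by
  refine isDiscrete_iff_forall_mem_exists_isOpen.2 fun x hx => ?_
  choose U hU hUx using fun i => isDiscrete_iff_forall_mem_exists_isOpen.1 (hS i) (x i) (hx i trivial)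
  refine ⟨univ.pi U, isOpen_set_pi finite_univ fun i _ => hU i, ?_⟩
  rw [← pi_inter_distrib]
  simp only [hUx]
  exact univ_pi_singleton x

/-- Coordinates are frozen one at a time: an open set on which `A` is constant in the coordinates of
`s` is shrunk by isolating a point in its next projection. -/
theorem IsScatteredSet.univ_pi {ι X : Type*} [Finite ι] [TopologicalSpace X] {S : ι → Set X}
    (hS : ∀ i, IsScatteredSet (S i)) : IsScatteredSet (univ.pi S) := by
  classical
  cases nonempty_fintype ι
  intro A hA hne
  have key : ∀ s : Finset ι, ∃ a ∈ A, ∃ U : Set (ι → X), IsOpen U ∧ a ∈ U ∧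
      ∀ b ∈ U ∩ A, ∀ i ∈ s, b i = a i := by
    intro s
    induction s using Finset.induction_on with
    | empty =>
      obtain ⟨a, ha⟩ := hne
      exact ⟨a, ha, univ, isOpen_univ, trivial, by simp⟩
    | insert i s _ ih =>
      obtain ⟨a, ha, U, hU, haU, h⟩ := ih
      obtain ⟨_, ⟨b, ⟨hbU, hbA⟩, rfl⟩, V, hV, hVb⟩ := hS i (Function.eval i '' (U ∩ A))
        (by rintro _ ⟨c, hc, rfl⟩; exact hA hc.2 i trivial) ⟨_, a, ⟨haU, ha⟩, rfl⟩
      have hbV : b i ∈ V := (hVb.symm ▸ mem_singleton (b i) :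
        b i ∈ V ∩ Function.eval i '' (U ∩ A)).1
      refine ⟨b, hbA, U ∩ Function.eval i ⁻¹' V, hU.inter (hV.preimage (continuous_apply i)),
        ⟨hbU, hbV⟩, ?_⟩
      rintro c ⟨⟨hcU, hcV⟩, hcA⟩ j hj
      rcases Finset.mem_insert.1 hj with rfl | hj
      · have : c j ∈ V ∩ Function.eval j '' (U ∩ A) := ⟨hcV, c, ⟨hcU, hcA⟩, rfl⟩
        rw [hVb] at this
        exact this
      · rw [h c ⟨hcU, hcA⟩ j hj, h b ⟨hbU, hbA⟩ j hj]
  obtain ⟨a, ha, U, hU, haU, h⟩ := key Finset.univ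
  refine ⟨a, ha, U, hU, Subset.antisymm (fun b hb => funext fun i => h b hb i (Finset.mem_univ i)) ?_⟩
  rintro _ rfl
  exact ⟨haU, ha⟩

/-- Isolate a point of the image of `A`, then delete the finitely many other points of its fiber. -/
theorem IsScatteredSet.preimage_of_finite_fibers {E Z : Type*} [TopologicalSpace E] [T1Space E]
    [TopologicalSpace Z] {q : E → Z} (hq : Continuous q) (hfin : ∀ z, (q ⁻¹' {z}).Finite)
    {S : Set Z} (hS : IsScatteredSet S) : IsScatteredSet (q ⁻¹' S) := by
  intro A hA hne
  obtain ⟨_, ⟨a, ha, rfl⟩, U, hU, hUa⟩ := hS (q '' A) (image_subset_iff.2 hA) (hne.image q)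
  have haU : q a ∈ U := (hUa.symm ▸ mem_singleton (q a) : q a ∈ U ∩ q '' A).1
  refine ⟨a, ha, q ⁻¹' U \ (q ⁻¹' {q a} \ {a}),
    (hU.preimage hq).sdiff ((hfin _).subset sdiff_subset).isClosed, Subset.antisymm ?_ ?_⟩
  · rintro b ⟨⟨hbU, hb⟩, hbA⟩
    have : q b ∈ U ∩ q '' A := ⟨hbU, b, hbA, rfl⟩
    rw [hUa] at this
    by_contra hne
    exact hb ⟨this, hne⟩
  · rintro _ rfl
    exact ⟨⟨haU, fun h => h.2 rfl⟩, ha⟩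

/-! ### Pushing forward along finite-sheeted maps -/

/-- A locally injective map with finite fibers that is closed, in the sense that points over `z'`
near `z` lie near the fiber over `z`. -/
structure IsFiniteSheeted {E Z : Type*} [TopologicalSpace E] [TopologicalSpace Z] (p : E → Z) :
    Prop where
  finite_fiber : ∀ z, (p ⁻¹' {z}).Finite
  locally_injOn : ∀ e, ∃ O ∈ 𝓝 e, InjOn p O
  eventually_near_fiber : ∀ (z : Z) (O : E → Set E), (∀ e, O e ∈ 𝓝 e) →
    ∀ᶠ z' in 𝓝 z, ∀ e', p e' = z' → ∃ e, p e = z ∧ e' ∈ O e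

namespace IsFiniteSheeted

variable {E Z : Type*} [TopologicalSpace E] [TopologicalSpace Z] {p : E → Z}

theorem eventually_exists_injOn (hp : IsFiniteSheeted p) (B : Set E) (z : Z) {O : E → Set E}
    (hO : ∀ e, O e ∈ 𝓝 e) : ∀ᶠ z' in 𝓝 z, ∃ g : E → E,
      MapsTo g (p ⁻¹' {z'} ∩ closure B) (p ⁻¹' {z} ∩ closure B) ∧
      InjOn g (p ⁻¹' {z'} ∩ closure B) ∧ ∀ e ∈ p ⁻¹' {z'} ∩ closure B, e ∈ O (g e) := by
  classical
  choose I hI hinj using hp.locally_injOn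
  -- Fiber points outside `closure B` get a neighborhood missing it, so no point of `closure B` is
  -- matched to them.
  filter_upwards [hp.eventually_near_fiber z
    (fun e => if e ∈ closure B then O e ∩ I e else (closure B)ᶜ) (fun e => by
      split_ifs with he
      · exact inter_mem (hO e) (hI e)
      · exact isClosed_closure.isOpen_compl.mem_nhds he)] with z' hz'
  have : ∀ e', ∃ e, e' ∈ p ⁻¹' {z'} ∩ closure B →
      e ∈ p ⁻¹' {z} ∩ closure B ∧ e' ∈ O e ∩ I e := by
    intro e'
    by_cases he' : e' ∈ p ⁻¹' {z'} ∩ closure B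
    · obtain ⟨e, he, h⟩ := hz' e' he'.1
      split_ifs at h with hB
      · exact ⟨e, fun _ => ⟨⟨he, hB⟩, h⟩⟩
      · exact absurd he'.2 h
    · exact ⟨e', fun h => absurd h he'⟩
  choose g hg using this
  refine ⟨g, fun e he => (hg e he).1, fun a ha b hb hab => ?_, fun e he => (hg e he).2.1⟩
  exact hinj (g a) (hg a ha).2.2 (hab ▸ (hg b hb).2.2) (ha.1.trans hb.1.symm)

theorem eventually_ncard_le (hp : IsFiniteSheeted p) (B : Set E) (z : Z) :
    ∀ᶠ z' in 𝓝 z, (p ⁻¹' {z'} ∩ closure B).ncard ≤ (p ⁻¹' {z} ∩ closure B).ncard := by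
  filter_upwards [hp.eventually_exists_injOn B z (fun _ => univ_mem)] with z' ⟨g, hg, hinj, _⟩
  exact ncard_le_ncard_of_injOn g hg hinj ((hp.finite_fiber z).inter_of_left _)

/-- Equal counts make the injection between fibers bijective, so some point of `closure B` over `z'`
lies in `U`, hence in the closure of `U ∩ B`, and is `b` itself. -/
theorem eventually_eq_of_ncard_eq [T1Space E] (hp : IsFiniteSheeted p) {B U : Set E} {b : E}
    (hU : IsOpen U) (hUb : U ∩ B = {b}) : ∀ᶠ z' in 𝓝 (p b),
      (p ⁻¹' {z'} ∩ closure B).ncard = (p ⁻¹' {p b} ∩ closure B).ncard → z' = p b := by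
  classical
  have hb : b ∈ U ∩ B := hUb.symm ▸ mem_singleton b
  filter_upwards [hp.eventually_exists_injOn B (p b) (O := fun e => if e = b then U else univ)
    (fun e => by
      split_ifs with h
      · exact h ▸ hU.mem_nhds hb.1
      · exact univ_mem)] with z' ⟨g, hg, hinj, hgO⟩ hcard
  have himg : g '' (p ⁻¹' {z'} ∩ closure B) = p ⁻¹' {p b} ∩ closure B :=
    eq_of_subset_of_ncard_le hg.image_subset (by rw [hinj.ncard_image, hcard])
      ((hp.finite_fiber _).inter_of_left _)
  obtain ⟨e, he, heb⟩ : b ∈ g '' (p ⁻¹' {z'} ∩ closure B) := himg ▸ ⟨rfl, subset_closure hb.2⟩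
  have heU : e ∈ U := by simpa [heb] using hgO e he
  have : e ∈ closure (U ∩ B) := hU.inter_closure ⟨heU, he.2⟩
  rw [hUb, closure_singleton] at this
  rw [← he.1, mem_singleton_iff.1 this]

theorem isDiscrete_image_inter [T1Space E] (hp : IsFiniteSheeted p) {D : Set E} (hD : IsDiscrete D)
    (c : ℕ) : IsDiscrete (p '' D ∩ {z | (p ⁻¹' {z} ∩ closure D).ncard = c}) := by
  refine isDiscrete_iff_forall_mem_exists_isOpen.2 ?_
  rintro _ ⟨⟨b, hb, rfl⟩, hc⟩
  obtain ⟨U, hU, hUb⟩ := isDiscrete_iff_forall_mem_exists_isOpen.1 hD b hb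
  obtain ⟨W, hW, hWo, hbW⟩ := eventually_nhds_iff.1 (hp.eventually_eq_of_ncard_eq hU hUb)
  refine ⟨W, hWo, Subset.antisymm (fun z hz => hW z hz.1 (hz.2.2.trans hc.symm)) ?_⟩
  rintro _ rfl
  exact ⟨hbW, ⟨b, hb, rfl⟩, hc⟩

theorem isScatteredSet_image [T1Space E] (hp : IsFiniteSheeted p) (hc : Continuous p) {D : Set E}
    (hD : IsScatteredSet D) : IsScatteredSet (p '' D) := by
  intro A hA hne
  set B := D ∩ p ⁻¹' A with hB
  set N : Z → ℕ := fun z => (p ⁻¹' {z} ∩ closure B).ncard with hN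
  -- At a minimum over `A`, upper semicontinuity makes the count constant on `A` nearby.
  obtain ⟨z₀, hz₀, hmin⟩ : ∃ z₀ ∈ A, ∀ z ∈ A, N z₀ ≤ N z := by
    obtain ⟨z, hz, h⟩ := WellFounded.has_min (measure N).wf A hne
    exact ⟨z, hz, fun w hw => not_lt.1 (h w hw)⟩
  obtain ⟨V, hV, hVo, hzV⟩ := eventually_nhds_iff.1 (hp.eventually_ncard_le B z₀)
  have hVA : ∀ z ∈ V ∩ A, N z = N z₀ := fun z hz => (hV z hz.1).antisymm (hmin z hz.2)
  obtain ⟨d, hd, rfl⟩ := hA hz₀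
  obtain ⟨b, ⟨hbV, hbB⟩, U, hU, hUb⟩ := hD (p ⁻¹' V ∩ B) (fun e he => he.2.1) ⟨d, hzV, hd, hz₀⟩
  rw [← inter_assoc] at hUb
  obtain ⟨W, hW, hWo, hbW⟩ := eventually_nhds_iff.1
    (hp.eventually_eq_of_ncard_eq (hU.inter (hVo.preimage hc)) hUb)
  refine ⟨p b, hbB.2, W ∩ V, hWo.inter hVo, Subset.antisymm ?_ ?_⟩
  · rintro z ⟨⟨hzW, hzV⟩, hzA⟩
    exact hW z hzW ((hVA z ⟨hzV, hzA⟩).trans (hVA _ ⟨hbV, hbB.2⟩).symm)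
  · rintro _ rfl
    exact ⟨⟨hbW, hbV⟩, hbB.2⟩

theorem isSigmaDiscrete {ι X : Type*} [Finite ι] [TopologicalSpace X] [T1Space E]
    (hp : IsFiniteSheeted p) (hsurj : Function.Surjective p) {q : E → ι → X} (hq : Continuous q)
    (hfin : ∀ x, (q ⁻¹' {x}).Finite) (hX : IsSigmaDiscrete X) : IsSigmaDiscrete Z := by
  obtain ⟨S, hS, hd⟩ := hX
  have hE (k : ι → ℕ) : IsDiscrete (q ⁻¹' univ.pi fun i => S (k i)) :=
    (isDiscrete_univ_pi fun i => hd (k i)).preimage' hq.continuousOn fun x =>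
      ⟨(hfin x).instDiscreteTopology⟩
  refine exists_nat_cover_of_countable (ι := (ι → ℕ) × ℕ)
    (eq_univ_of_forall fun z => ?_) fun i => hp.isDiscrete_image_inter (hE i.1) i.2
  obtain ⟨e, rfl⟩ := hsurj z
  choose k hk using fun i => mem_iUnion.1 (hS ▸ mem_univ (q e i))
  exact mem_iUnion.2 ⟨(k, (p ⁻¹' {p e} ∩ closure (q ⁻¹' univ.pi fun i => S (k i))).ncard),
    ⟨e, fun i _ => hk i, rfl⟩, rfl⟩

theorem isSigmaScattered {ι X : Type*} [Finite ι] [TopologicalSpace X] [T1Space E]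
    (hp : IsFiniteSheeted p) (hc : Continuous p) (hsurj : Function.Surjective p) {q : E → ι → X}
    (hq : Continuous q) (hfin : ∀ x, (q ⁻¹' {x}).Finite) (hX : IsSigmaScattered X) :
    IsSigmaScattered Z := by
  obtain ⟨S, hS, hd⟩ := hX
  refine exists_nat_cover_of_countable (ι := ι → ℕ) (eq_univ_of_forall fun z => ?_) fun k =>
    hp.isScatteredSet_image hc
      ((IsScatteredSet.univ_pi fun i => hd (k i)).preimage_of_finite_fibers hq hfin)
  obtain ⟨e, rfl⟩ := hsurj z
  choose k hk using fun i => mem_iUnion.1 (hS ▸ mem_univ (q e i))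
  exact mem_iUnion.2 ⟨k, e, fun i _ => hk i, rfl⟩

end IsFiniteSheeted

/-! ### Enumerated supports -/

section Enumeration

variable {X Y : Type*} {l : Y → X →₀ ℝ}

/-- Vectors supported in `F` form a finite-dimensional space, which holds only finitely many
independent ones. -/
theorem finite_setOf_support_subset (hl : LinearIndependent ℝ l)
    {F : Set X} (hF : F.Finite) : {y | ((l y).support : Set X) ⊆ F}.Finite := by
  have := hF.to_subtype
  have : Module.Finite ℝ (Finsupp.supported ℝ ℝ F) :=
    Module.Finite.equiv (Finsupp.supportedEquivFinsupp F).symm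
  let v : {y | ((l y).support : Set X) ⊆ F} → Finsupp.supported ℝ ℝ F :=
    fun y => ⟨l y, (Finsupp.mem_supported ℝ _).2 y.2⟩
  have hv : LinearIndependent ℝ v :=
    LinearIndependent.of_comp (Finsupp.supported ℝ ℝ F).subtype
      (hl.comp Subtype.val Subtype.val_injective)
  have := hv.finite
  exact toFinite _

/-- The pairs of a point whose support has `n` elements and an enumeration of that support. -/
abbrev SupportEnumeration (l : Y → X →₀ ℝ) (n : ℕ) : Type _ :=
  {e : {y // (l y).support.card = n} × (Fin n → X) //
    Function.Injective e.2 ∧ range e.2 = (l e.1.1).support}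

theorem SupportEnumeration.surjective_fst (n : ℕ) :
    Function.Surjective fun e : SupportEnumeration l n => e.1.1 := by
  intro z
  let g := (l z.1).support.equivFinOfCardEq z.2
  exact ⟨⟨(z, fun i => (g.symm i).1), Subtype.val_injective.comp g.symm.injective,
    by rw [range_comp' Subtype.val g.symm, g.symm.range_eq_univ, image_univ]; exact Subtype.range_coe⟩, rfl⟩

theorem SupportEnumeration.finite_fiber_snd (hl : LinearIndependent ℝ l) {n : ℕ} (x : Fin n → X) :
    ((fun e : SupportEnumeration l n => e.1.2) ⁻¹' {x}).Finite := by
  refine Finite.of_finite_image (f := fun e : SupportEnumeration l n => e.1.1.1)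
    ((finite_setOf_support_subset hl (finite_range x)).subset ?_) ?_
  · rintro _ ⟨e, he, rfl⟩
    rw [← mem_singleton_iff.1 he]
    exact e.2.2.ge
  · intro a ha b hb hab
    exact Subtype.ext (Prod.ext (Subtype.ext hab) (ha.trans hb.symm))

theorem SupportEnumeration.finite_fiber_fst {n : ℕ} (z : {y // (l y).support.card = n}) :
    ((fun e : SupportEnumeration l n => e.1.1) ⁻¹' {z}).Finite := by
  refine Finite.of_finite_image (f := fun e : SupportEnumeration l n => e.1.2)
    ((Finite.pi' fun _ : Fin n => (l z.1).support.finite_toSet).subset ?_) ?_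
  · rintro _ ⟨e, he, rfl⟩ i
    rw [← mem_singleton_iff.1 he, ← e.2.2]
    exact mem_range_self i
  · intro a ha b hb hab
    exact Subtype.ext (Prod.ext (ha.trans hb.symm) hab)

end Enumeration

/-! ### Supports of the functionals and their continuity -/

section Support

variable {X Y : Type*} [TopologicalSpace X] [TopologicalSpace Y]

/-- The topology of `Cp X` is induced by the evaluations, so a continuous functional lies in their
span. -/
theorem exists_finsupp_of_continuous_functional (φ : Cp X →L[ℝ] ℝ) :
    ∃ l : X →₀ ℝ, ∀ f : Cp X, φ f = l.sum fun x r => r * f.1 x := by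
  let ev : X → Cp X →ₗ[ℝ] ℝ := fun x => (LinearMap.proj x).comp (Cp X).subtype
  have htop : (⨅ x, TopologicalSpace.induced (ev x) inferInstance) =
      (inferInstance : TopologicalSpace (Cp X)) := by
    rw [instTopologicalSpaceSubtype, Pi.topologicalSpace, induced_iInf]
    simp only [induced_compose]
    rfl
  have hφ : (φ : Cp X →ₗ[ℝ] ℝ) ∈ Submodule.span ℝ (range ev) := by
    rw [LinearMap.mem_span_iff_continuous, htop]
    exact φ.continuous
  obtain ⟨l, hl⟩ := Finsupp.mem_span_range_iff_exists_finsupp.1 hφ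
  refine ⟨l, fun f => ?_⟩
  have := LinearMap.congr_fun hl f
  simp only [Finsupp.sum, LinearMap.sum_apply] at this
  exact this.symm

theorem exists_cp_eq_one_of_isClosed [CompletelyRegularSpace X] {x : X} {K : Set X}
    (hK : IsClosed K) (hx : x ∉ K) : ∃ f : Cp X, f.1 x = 1 ∧ ∀ z ∈ K, f.1 z = 0 := by
  obtain ⟨f, hf, hfx, hfK⟩ := CompletelyRegularSpace.completely_regular x K hK hx
  refine ⟨⟨fun z => 1 - (f z : ℝ), continuous_const.sub (continuous_subtype_val.comp hf)⟩, ?_, ?_⟩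
  · simp [hfx]
  · intro z hz
    simp [hfK hz]

variable {T : Cp X →L[ℝ] Cp Y} {l : Y → X →₀ ℝ}

theorem eventually_support_inter_nonempty [T35Space X]
    (hl : ∀ (f : Cp X) (y : Y), (T f).1 y = (l y).sum fun x r => r * f.1 x) {y : Y} {x : X}
    (hx : x ∈ (l y).support) {U : Set X} (hU : U ∈ 𝓝 x) :
    ∀ᶠ y' in 𝓝 y, ∃ x' ∈ (l y').support, x' ∈ U := by
  classical
  obtain ⟨V, hVU, hV, hxV⟩ := mem_nhds_iff.1 hU
  -- Such an `f` sees only `x` among the support of `l y`, so `T f` at `y` is the nonzero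
  -- coefficient of `x`.
  obtain ⟨f, hfx, hf⟩ := exists_cp_eq_one_of_isClosed (x := x)
    (hV.isClosed_compl.union ((l y).support.erase x).finite_toSet.isClosed)
    (by simp [hxV])
  have hne : (T f).1 y ≠ 0 := by
    rw [hl, Finsupp.sum, Finset.sum_eq_single_of_mem x hx, hfx, mul_one]
    · exact Finsupp.mem_support_iff.1 hx
    · intro z hz hzx
      rw [hf z (Or.inr (Finset.mem_coe.2 (Finset.mem_erase.2 ⟨hzx, hz⟩))), mul_zero]
  filter_upwards [(T f).2.continuousAt.eventually_ne hne] with y' hy'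
  rw [hl] at hy'
  obtain ⟨x', hx', h⟩ := Finset.exists_ne_zero_of_sum_ne_zero hy'
  refine ⟨x', hx', hVU ?_⟩
  by_contra hx'V
  exact h (by simp only [hf x' (Or.inl hx'V), mul_zero])

/-- A preimage under `T` of a function that is 1 at `y` and 0 at the other points of `s` picks out
the coefficient of `y`. -/
theorem linearIndependent_of_surjective [T35Space Y] (hT : Function.Surjective T)
    (hl : ∀ (f : Cp X) (y : Y), (T f).1 y = (l y).sum fun x r => r * f.1 x) :
    LinearIndependent ℝ l := by
  classical
  rw [linearIndependent_iff']
  intro s g hg y hy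
  obtain ⟨h, hhy, hh⟩ := exists_cp_eq_one_of_isClosed (x := y) (s.erase y).finite_toSet.isClosed
    (by simp)
  obtain ⟨f, rfl⟩ := hT h
  have hlin (y : Y) : (T f).1 y = Finsupp.linearCombination ℝ f.1 (l y) := by
    rw [hl, Finsupp.linearCombination_apply]; rfl
  have := congrArg (Finsupp.linearCombination ℝ f.1) hg
  rw [map_sum, map_zero, Finset.sum_eq_single_of_mem y hy, map_smul, ← hlin, hhy] at this
  · simpa using this
  · intro z hz hzy
    rw [map_smul, ← hlin, hh z (Finset.mem_coe.2 (Finset.mem_erase.2 ⟨hzy, hz⟩)), smul_zero]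

theorem SupportEnumeration.isFiniteSheeted_fst [T35Space X]
    (hl : ∀ (f : Cp X) (y : Y), (T f).1 y = (l y).sum fun x r => r * f.1 x) (n : ℕ) :
    IsFiniteSheeted fun e : SupportEnumeration l n => e.1.1 where
  finite_fiber := finite_fiber_fst
  locally_injOn e := by
    obtain ⟨U, hU, hdisj⟩ := (finite_range e.1.2).t2_separation
    refine ⟨{a | ∀ i, a.1.2 i ∈ U (e.1.2 i)}, ?_, fun a ha b hb hab => ?_⟩
    · have : Continuous fun a : SupportEnumeration l n => a.1.2 :=
        continuous_snd.comp continuous_subtype_val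
      exact eventually_all.2 fun i => (((continuous_apply i).comp this).continuousAt).preimage_mem_nhds
        ((hU _).2.mem_nhds (hU _).1)
    · refine Subtype.ext (Prod.ext hab (funext fun i => ?_))
      have hi : a.1.2 i ∈ range b.1.2 := by
        rw [b.2.2, ← show a.1.1 = b.1.1 from hab, ← a.2.2]
        exact mem_range_self i
      obtain ⟨j, hj⟩ := hi
      have hij : e.1.2 j = e.1.2 i := hdisj.elim (mem_range_self j) (mem_range_self i)
        (not_disjoint_iff.2 ⟨_, hb j, hj ▸ ha i⟩)
      rw [← hj, e.2.1 hij]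
  eventually_near_fiber z O hO := by
    have hbox (e : SupportEnumeration l n) : ∃ V ∈ 𝓝 e.1.1, ∃ N : Fin n → Set X,
        (∀ i, N i ∈ 𝓝 (e.1.2 i)) ∧ ∀ a : SupportEnumeration l n, a.1.1 ∈ V →
          (∀ i, a.1.2 i ∈ N i) → a ∈ O e := by
      obtain ⟨W, hW, hWO⟩ := mem_nhds_induced _ _ _ |>.1 (hO e)
      obtain ⟨V, hV, M, hM, hVM⟩ := mem_nhds_prod_iff.1 hW
      rw [nhds_pi, Filter.mem_pi'] at hM
      obtain ⟨I, N, hN, hNM⟩ := hM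
      exact ⟨V, hV, N, hN, fun a haV haN => hWO (hVM ⟨haV, hNM fun i _ => haN i⟩)⟩
    choose V hV N hN hVN using hbox
    obtain ⟨U, hU, hdisj⟩ := (l z.1).support.finite_toSet.t2_separation
    let Φ := (fun e : SupportEnumeration l n => e.1.1) ⁻¹' {z}
    have hΦ : Φ.Finite := finite_fiber_fst z
    -- Disjoint neighborhoods, small enough to serve every enumeration of the support of `l z` at
    -- once. Each meets the support of a nearby `l z'`; as both supports have `n` points, this
    -- matches them bijectively, and the enumeration `e'` transports back to `z`.
    let G : X → Set X := fun x => U x ∩ ⋂ e ∈ Φ, ⋂ i, {w | e.1.2 i = x → w ∈ N e i}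
    have hG (x : X) : G x ∈ 𝓝 x := by
      refine inter_mem ((hU x).2.mem_nhds (hU x).1) ((biInter_mem hΦ).2 fun e _ =>
        iInter_mem.2 fun i => ?_)
      by_cases h : e.1.2 i = x
      · subst h
        simpa using hN e i
      · simp [h]
    have hmeet : ∀ᶠ z' : {y // (l y).support.card = n} in 𝓝 z, ∀ x ∈ (l z.1).support,
        ∃ x' ∈ (l z'.1).support, x' ∈ G x :=
      continuous_subtype_val.continuousAt.eventually ((Finset.eventually_all _).2 fun x hx =>
        eventually_support_inter_nonempty hl hx (hG x))
    have hVz : ∀ᶠ z' in 𝓝 z, ∀ e ∈ Φ, z' ∈ V e :=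
      (eventually_all_finite hΦ).2 fun e he => (mem_singleton_iff.1 he) ▸ hV e
    filter_upwards [hmeet, hVz] with z' hz' hzV e' he'
    subst he'
    choose! τ hτ hτG using hz'
    have hτinj : InjOn τ (l z.1).support := fun x hx w hw hxw =>
      hdisj.elim hx hw (not_disjoint_iff.2 ⟨_, (hτG x hx).1, hxw ▸ (hτG w hw).1⟩)
    have hτimg : τ '' (l z.1).support = (l e'.1.1.1).support := by
      refine eq_of_subset_of_ncard_le (image_subset_iff.2 hτ) ?_ (Finset.finite_toSet _)
      rw [hτinj.ncard_image, ncard_coe_finset, ncard_coe_finset, z.2, e'.1.1.2]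
    have hx (i : Fin n) : ∃ x ∈ (l z.1).support, τ x = e'.1.2 i := by
      have : e'.1.2 i ∈ τ '' (l z.1).support := by
        rw [hτimg, ← e'.2.2]
        exact mem_range_self i
      exact this
    choose x hx hxτ using hx
    have hxinj : Function.Injective x := fun i j hij =>
      e'.2.1 (by rw [← hxτ i, ← hxτ j, hij])
    have hxr : range x = (l z.1).support := by
      refine eq_of_subset_of_ncard_le (range_subset_iff.2 hx) ?_ (Finset.finite_toSet _)
      rw [← image_univ, hxinj.injOn.ncard_image, ncard_univ, ncard_coe_finset, z.2, Nat.card_fin]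
    let e : SupportEnumeration l n := ⟨(z, x), hxinj, hxr⟩
    refine ⟨e, rfl, hVN e e' (hzV e rfl) fun i => ?_⟩
    have := (hτG (x i) (hx i)).2
    rw [hxτ] at this
    exact mem_iInter.1 (mem_iInter₂.1 this e rfl) i rfl

end Support

theorem proposition3p6 {X Y : Type*} [TopologicalSpace X] [TopologicalSpace Y]
    [T35Space X] [T35Space Y] (h : LDominatedBy Y X) :
    (IsSigmaScattered X → IsSigmaScattered Y) ∧ (IsSigmaDiscrete X → IsSigmaDiscrete Y) := by
  obtain ⟨T, hT⟩ := h
  choose l hl using fun y : Y => exists_finsupp_of_continuous_functional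
    (((ContinuousLinearMap.proj y).comp (Cp Y).subtypeL).comp T)
  replace hl (f : Cp X) (y : Y) : (T f).1 y = (l y).sum fun x r => r * f.1 x := hl y f
  have hind := linearIndependent_of_surjective hT hl
  have hp := SupportEnumeration.isFiniteSheeted_fst hl
  have hc (n : ℕ) : Continuous fun e : SupportEnumeration l n => e.1.1 :=
    continuous_fst.comp continuous_subtype_val
  have hq (n : ℕ) : Continuous fun e : SupportEnumeration l n => e.1.2 :=
    continuous_snd.comp continuous_subtype_val
  exact ⟨fun hX => isSigmaScattered_of_levels (fun y => (l y).support.card) fun n =>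
      (hp n).isSigmaScattered (hc n) (SupportEnumeration.surjective_fst n) (hq n)
        (SupportEnumeration.finite_fiber_snd hind) hX,
    fun hX => isSigmaDiscrete_of_levels (fun y => (l y).support.card) fun n =>
      (hp n).isSigmaDiscrete (SupportEnumeration.surjective_fst n) (hq n)
        (SupportEnumeration.finite_fiber_snd hind) hX⟩
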